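/- Let $S$ be a finite nonempty set of states, $\Sigma$ an algebra of subsets of $S$, $X$ a convex subset of a real vector space, and $\mathscr F=X^S$ the set of acts; $x\in X$ also denotes the constant act with value $x$. For $f,g\in\mathscr F$ and $A\in\Sigma$, $fAg$ is the act equal to $f$ on $A$ and to $g$ on $S\setminus A$; mixtures of acts are pointwise. $\Delta(S)$ is the set of probabilities on $S$; for $\alpha\in\Delta(S)$ put $\alpha(A)=\sum_{s\in A}\alpha(s)$, let $f^\alpha$ be the constant act with value $\sum_s\alpha(s)f(s)$, and, if $\alpha(A)>0$, let $\alpha_A(s)=\alpha(s)/\alpha(A)$ for $s\in A$ and $\alpha_A(s)=0$ otherwise, and $[\alpha_A]=\{\beta\in\Delta(S):\beta(A)>0,\ \beta_A=\alpha_A\}$. Let $(\succsim_A)$ be a family of binary relations on $\mathscr F$ indexed by the nonempty $A\in\Sigma$, with $\succ_A,\sim_A$ the asymmetric and symmetric parts, and $\succsim\,=\,\succsim_S$. Assume, for each nonempty $A\in\Sigma$: *Conditional MEU:* (weak order) $\succsim_A$ is complete and transitive; (certainty independence) for $f,g\in\mathscr F$, $x\in X$, $\lambda\in(0,1]$: $f\succsim_A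 g\Leftrightarrow\lambda f+(1-\lambda)x\succsim_A\lambda g+(1-\lambda)x$; (continuity) if $f\succ_A g\succ_A h$, there are $\lambda,\gamma\in(0,1)$ with $\lambda f+(1-\lambda)h\succ_A g\succ_A\gamma f+(1-\gamma)h$; (monotonicity) if $f(s)\succsim_A g(s)$ for all $s\in A$, then $f\succsim_A g$; (ambiguity aversion) if $f\sim_A g$, then $\lambda f+(1-\lambda)g\succsim_A f$ for all $\lambda\in[0,1]$; (non-degeneracy) $f\succ_A g$ for some $f,g$; (ordinal preference consistency) for all $x,y\in X$, $x\succsim y\Leftrightarrow x\succsim_A y$. *Consequentialism:* if $f(s)=g(s)$ for all $s\in A$, then $f\sim_A g$. A pair $(u,\mathscr C)$ is an *MEU representation* of a relation $R$ on $\mathscr F$ if $u:X\to\mathbb R$ is affine and nonconstant, $\mathscr C\subseteq\Delta(S)$ is nonempty, closed and convex, and $f\,R\,g\Leftrightarrow\min_{\pi\in\mathscr C}\sum_s u(f(s))\pi(s)\ge\min_{\pi\in\mathscr C}\sum_s u(g(s))\pi(s)$. For $r\in[0,1]$ let $\mathscr C_A^{r}=\{\pi_A:\pi\in\mathscr C,\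 \pi(A)>0,\ \pi(A)\ge r\max_{\mu\in\mathscr C}\mu(A)\}$. An event $A\in\Sigma$ is *strongly nonnull* if $x\succ y$ implies $xAy\succ y$ for all $x,y\in X$. *Partial Bayesian updating at $A$ with threshold $r$, for $(u,\mathscr C)$*, means that $(u,\mathscr C)$ is an MEU representation of $\succsim$ and $(u,\mathscr C_A^{r})$ one of $\succsim_A$. A *partial Bayesian (PB) representation* of the family is a triple $(u,\mathscr C,\rho)$ such that $(u,\mathscr C)$ is an MEU representation of $\succsim$ and, for each strongly nonnull $A\in\Sigma$, $\rho(A)\in[0,1]$ and partial Bayesian updating at $A$ with threshold $\rho(A)$ holds for $(u,\mathscr C)$. Then: 1. For each nonempty $A\in\Sigma$ there is $\alpha\in\Delta(S)$ with $\alpha(s)=0$ for all $s\in S\setminus A$ and $f^{\alpha}\succsim_A f$ for all $f\in\mathscr F$. 2. For each strongly nonnull $A\in\Sigma$ the following are equivalent: (i) for some $(u,\mathscr C)$, partial Bayesian updating at $A$ with threshold $0$ (full Bayesian updating at $A$) holds; (ii) for every $\alpha\in\Delta(S)$ with $\alpha(A)>0$: (a) if $f^{\alpha}\succsim f$ for all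 $f\in\mathscr F$, then $f^{\alpha_A}\succsim_A f$ for all $f\in\mathscr F$; and (b) if $f^{\alpha_A}\succsim_A f$ for all $f\in\mathscr F$, then there is $\beta\in[\alpha_A]$ with $f^{\beta}\succsim f$ for all $f\in\mathscr F$; (iii) for all $f\in\mathscr F$ and $x\in X$, $fAx\sim x\Leftrightarrow f\sim_A x$. 3. The following are also equivalent: the family has a PB representation $(u,\mathscr C,\rho)$ with $\rho(A)=0$ for every strongly nonnull $A\in\Sigma$; (ii) holds for every strongly nonnull $A\in\Sigma$; (iii) holds for every strongly nonnull $A\in\Sigma$. -/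

import Mathlib

namespace PBU

noncomputable section

variable {S E : Type*} [Fintype S] [AddCommGroup E] [Module ℝ E] {X : Set E}

/-! ### Acts

`S` is the finite set of states, the convex set `X` in the real vector space `E` is the set of
consequences, and an act is a function `S → X`. -/

/-- The constant act with value `x`. -/
def cst (S : Type*) {E : Type*} {X : Set E} (x : X) : S → X := fun _ => x

open Classical in
/-- The composite act `fAg`: it returns `f s` on `A` and `g s` off `A`. -/
def splice {S E : Type*} {X : Set E} (f : S → X) (A : Set S) (g : S → X) : S → X :=
  fun s => if s ∈ A then f s else g s

/-- The mixture `t x + (1 - t) y` of two consequences. -/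
def mixC (hX : Convex ℝ X) (t : Set.Icc (0 : ℝ) 1) (x y : X) : X :=
  ⟨(t : ℝ) • (x : E) + (1 - (t : ℝ)) • (y : E),
    hX x.2 y.2 t.2.1 (sub_nonneg.2 t.2.2) (by ring)⟩

/-- The pointwise mixture `t f + (1 - t) g` of two acts. -/
def mix {S : Type*} (hX : Convex ℝ X) (t : Set.Icc (0 : ℝ) 1) (f g : S → X) : S → X :=
  fun s => mixC hX t (f s) (g s)

/-! ### Probabilities and randomizations

`Δ(S)` is `stdSimplex ℝ S`. -/

/-- The weight `π(A) = ∑_{s ∈ A} π(s)`. -/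
def prob (π : S → ℝ) (A : Set S) : ℝ := ∑ s, A.indicator π s

/-- The Bayesian update `π_A`: `π(s) / π(A)` for `s ∈ A`, and `0` otherwise. It is only used when
`π(A) > 0`. -/
def condFun (π : S → ℝ) (A : Set S) : S → ℝ := fun s => A.indicator π s / prob π A

theorem condFun_mem {π : S → ℝ} (hπ : π ∈ stdSimplex ℝ S) {A : Set S} (hA : 0 < prob π A) :
    condFun π A ∈ stdSimplex ℝ S := by
  refine ⟨fun s => div_nonneg (Set.indicator_nonneg (fun s _ => hπ.1 s) s) hA.le, ?_⟩
  simp only [condFun]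
  rw [← Finset.sum_div]
  exact div_self hA.ne'

/-- The conditional randomization `α_A`, for `α ∈ Δ(S)` with `α(A) > 0`. -/
def condRand (α : stdSimplex ℝ S) (A : Set S) (hA : 0 < prob (α : S → ℝ) A) : stdSimplex ℝ S :=
  ⟨condFun (α : S → ℝ) A, condFun_mem α.2 hA⟩

/-- The consequence `∑ s, α(s) f(s)`. -/
def reduceC (hX : Convex ℝ X) (α : stdSimplex ℝ S) (f : S → X) : X :=
  ⟨∑ s, (α : S → ℝ) s • (f s : E),
    hX.sum_mem (fun s _ => α.2.1 s) α.2.2 (fun s _ => (f s).2)⟩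

/-- The act `f^α`: the constant act that yields the mixture of `f` according to `α`. -/
def reduce (hX : Convex ℝ X) (α : stdSimplex ℝ S) (f : S → X) : S → X :=
  cst S (reduceC hX α f)

/-! ### Preferences -/

/-- The asymmetric part of a relation. -/
def Strict {F : Type*} (R : F → F → Prop) (f g : F) : Prop := R f g ∧ ¬ R g f

/-- The symmetric part of a relation. -/
def Indiff {F : Type*} (R : F → F → Prop) (f g : F) : Prop := R f g ∧ R g f

/-- `ConditionalMEUAt hX R A RA` collects the postulates imposed on the preference `RA`
conditional on `A`, where `R` is the unconditional preference. -/
structure ConditionalMEUAt {S : Type*} (hX : Convex ℝ X) (R : (S → X) → (S → X) → Prop)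
    (A : Set S) (RA : (S → X) → (S → X) → Prop) : Prop where
  complete : ∀ f g, RA f g ∨ RA g f
  transitive : ∀ f g h, RA f g → RA g h → RA f h
  certainty_independence : ∀ (f g : S → X) (x : X) (t : Set.Icc (0 : ℝ) 1), 0 < (t : ℝ) →
    (RA f g ↔ RA (mix hX t f (cst S x)) (mix hX t g (cst S x)))
  continuity : ∀ f g h, Strict RA f g → Strict RA g h →
    ∃ t r : Set.Icc (0 : ℝ) 1, (t : ℝ) ∈ Set.Ioo (0 : ℝ) 1 ∧ (r : ℝ) ∈ Set.Ioo (0 : ℝ) 1 ∧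
      Strict RA (mix hX t f h) g ∧ Strict RA g (mix hX r f h)
  monotonicity : ∀ f g : S → X, (∀ s ∈ A, RA (cst S (f s)) (cst S (g s))) → RA f g
  ambiguity_aversion : ∀ f g, Indiff RA f g → ∀ t : Set.Icc (0 : ℝ) 1, RA (mix hX t f g) f
  nondegeneracy : ∃ f g, Strict RA f g
  ordinal_consistency : ∀ x y : X, R (cst S x) (cst S y) ↔ RA (cst S x) (cst S y)

/-- Conditional MEU for a family of preferences indexed by the nonempty events in `𝒮`; the
unconditional preference is the one given `Set.univ`. -/
def ConditionalMEU {S : Type*} (hX : Convex ℝ X) (𝒮 : Set (Set S))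
    (pref : Set S → (S → X) → (S → X) → Prop) : Prop :=
  ∀ A ∈ 𝒮, A.Nonempty → ConditionalMEUAt hX (pref Set.univ) A (pref A)

/-- Consequentialism, for a family of preferences indexed by the nonempty events in `𝒮`. -/
def Consequentialism {S E : Type*} {X : Set E} (𝒮 : Set (Set S))
    (pref : Set S → (S → X) → (S → X) → Prop) : Prop :=
  ∀ A ∈ 𝒮, A.Nonempty → ∀ f g : S → X, (∀ s ∈ A, f s = g s) → Indiff (pref A) f g

/-- `A` is strongly nonnull for `R`: if `x ≻ y` then `xAy ≻ y`. -/
def StronglyNonnull {S E : Type*} {X : Set E} (R : (S → X) → (S → X) → Prop) (A : Set S) : Prop :=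
  ∀ x y : X, Strict R (cst S x) (cst S y) → Strict R (splice (cst S x) A (cst S y)) (cst S y)

/-! ### Representations -/

/-- The maxmin value `min_{π ∈ C} ∑ s, u (f s) π(s)`. In `IsMEURep` the set `C` is nonempty and
compact, so that the infimum is attained. -/
def meuValue (u : X → ℝ) (C : Set (S → ℝ)) (f : S → X) : ℝ :=
  sInf ((fun π : S → ℝ => ∑ s, u (f s) * π s) '' C)

/-- `(u, C)` is a maxmin expected utility representation of `R`: `u` is affine and not constant,
`C` is a nonempty closed convex set of probabilities, and `R` compares maxmin values. -/
structure IsMEURep (hX : Convex ℝ X) (u : X → ℝ) (C : Set (S → ℝ))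
    (R : (S → X) → (S → X) → Prop) : Prop where
  affine : ∀ (x y : X) (t : Set.Icc (0 : ℝ) 1),
    u (mixC hX t x y) = (t : ℝ) * u x + (1 - (t : ℝ)) * u y
  nonconstant : ∃ x y, u x ≠ u y
  subset : C ⊆ stdSimplex ℝ S
  nonempty : C.Nonempty
  closed : IsClosed C
  convex : Convex ℝ C
  represents : ∀ f g, R f g ↔ meuValue u C g ≤ meuValue u C f

/-- The partial Bayesian posterior set with threshold `r`: the updates `π_A` of those `π ∈ C` that
satisfy `π(A) ≥ r * max_{μ ∈ C} μ(A)`. The condition `π(A) > 0`, which makes `π_A` meaningful, holds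
for every `π ∈ C` when `A` is strongly nonnull. -/
def pbUpdate (C : Set (S → ℝ)) (A : Set S) (r : ℝ) : Set (S → ℝ) :=
  {q | ∃ π ∈ C, 0 < prob π A ∧ r * sSup ((fun μ => prob μ A) '' C) ≤ prob π A ∧ q = condFun π A}

/-- `(u, C, r)` represents the unconditional preference and the preference conditional on the event
`A` by partial Bayesian updating with threshold `r` at `A`. -/
def IsPBRepAt (hX : Convex ℝ X) (pref : Set S → (S → X) → (S → X) → Prop)
    (u : X → ℝ) (C : Set (S → ℝ)) (A : Set S) (r : ℝ) : Prop :=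
  r ∈ Set.Icc (0 : ℝ) 1 ∧ IsMEURep hX u C (pref Set.univ) ∧
    IsMEURep hX u (pbUpdate C A r) (pref A)

/-- `(u, C, ρ)` is a partial Bayesian updating representation of the whole family. -/
def IsPBRep (hX : Convex ℝ X) (𝒮 : Set (Set S)) (pref : Set S → (S → X) → (S → X) → Prop)
    (u : X → ℝ) (C : Set (S → ℝ)) (ρ : Set S → ℝ) : Prop :=
  IsMEURep hX u C (pref Set.univ) ∧
    ∀ A ∈ 𝒮, StronglyNonnull (pref Set.univ) A → IsPBRepAt hX pref u C A (ρ A)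

/-! ### Consistency conditions -/

/-- `α` is an acceptable reduction for `R`: `f^α ≿ f` for all acts `f`. -/
def PrefersReduction (hX : Convex ℝ X) (R : (S → X) → (S → X) → Prop)
    (α : stdSimplex ℝ S) : Prop :=
  ∀ f : S → X, R (reduce hX α f) f

/-- The two-sided reduction consistency at `A`. In the second part, the randomizations `β` with
`β(A) > 0` and `β_A = α_A` are the elements of the class `[α_A]`. -/
def ReductionConsistent (hX : Convex ℝ X) (pref : Set S → (S → X) → (S → X) → Prop)
    (A : Set S) : Prop :=
  ∀ (α : stdSimplex ℝ S) (hα : 0 < prob (α : S → ℝ) A),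
    (PrefersReduction hX (pref Set.univ) α → PrefersReduction hX (pref A) (condRand α A hα)) ∧
    (PrefersReduction hX (pref A) (condRand α A hα) →
      ∃ (β : stdSimplex ℝ S) (hβ : 0 < prob (β : S → ℝ) A),
        condRand β A hβ = condRand α A hα ∧ PrefersReduction hX (pref Set.univ) β)

/-- Consistency of conditional certainty equivalents at `A`: `fAx ∼ x ↔ f ∼_A x`. -/
def CertaintyEquivConsistent {S E : Type*} {X : Set E}
    (pref : Set S → (S → X) → (S → X) → Prop) (A : Set S) : Prop :=
  ∀ (f : S → X) (x : X),
    Indiff (pref Set.univ) (splice f A (cst S x)) (cst S x) ↔ Indiff (pref A) f (cst S x)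

end

end PBU

namespace PBU

variable {S E : Type*} [AddCommGroup E] [Module ℝ E] {X : Set E}

/-! ### Mixtures -/

/-! Each conditional preference has a canonical prior set: its acceptable reductions, the α with f^α
≿_A f for all f. For any MEU representation (u, C) this set is C itself
(`IsMEURep.prefersReduction_iff`).

That it does represent ≿_A is the Gilboa–Schmeidler argument. Cone duality gives a utility u on
consequences (`IsVNM.exists_linear`), common to all events by ordinal consistency. Certainty
equivalents turn ≿_A into a concave functional V, affine in mixtures with constants
(`ConditionalMEUAt.exists_functional`). Hahn–Banach supports V at each act by a probability
(`IsMaxminFunctional.exists_support`), so V is a minimum of expectations over acceptable reductions,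
all of which live on A (`isMEURep_acceptable`).

At a strongly nonnull A every prior in C has π(A) > 0, and updating with threshold 0 is the image of
C under conditioning. Parts (a) and (b) of (ii) are then the two inclusions between this image and
the acceptable set of ≿_A. For (iii), E_π u(fAx) − u(x) = π(A)(E_{π_A} u(f) − u(x)), so fAx is worth
u(x) under C exactly when f is worth u(x) under the updates (`meuValue_splice_eq_iff`): (iii) says
that the updates give f its conditional certainty equivalent. -/

theorem coe_mixC (hX : Convex ℝ X) (t : Set.Icc (0 : ℝ) 1) (x y : X) :
    (mixC hX t x y : E) = (t : ℝ) • (x : E) + (1 - (t : ℝ)) • (y : E) := rfl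

theorem mixC_symm (hX : Convex ℝ X) (t : Set.Icc (0 : ℝ) 1) (x y : X) :
    mixC hX (unitInterval.symm t) x y = mixC hX t y x := by
  apply Subtype.ext
  simp only [coe_mixC, unitInterval.coe_symm_eq]
  module

theorem mixC_zero (hX : Convex ℝ X) {t : Set.Icc (0 : ℝ) 1} (ht : (t : ℝ) = 0) (x y : X) :
    mixC hX t x y = y := by
  apply Subtype.ext
  simp [coe_mixC, ht]

theorem mix_cst (hX : Convex ℝ X) (t : Set.Icc (0 : ℝ) 1) (x y : X) :
    mix hX t (cst S x) (cst S y) = cst S (mixC hX t x y) := rfl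

/-! ### Expected utility on consequences -/

/-- The von Neumann-Morgenstern postulates for a relation on a convex set. -/
structure IsVNM (hX : Convex ℝ X) (r : X → X → Prop) : Prop where
  total : ∀ x y, r x y ∨ r y x
  trans : ∀ x y z, r x y → r y z → r x z
  indep : ∀ (x y z : X) (t : Set.Icc (0 : ℝ) 1), 0 < (t : ℝ) →
    (r x y ↔ r (mixC hX t x z) (mixC hX t y z))
  archimedean : ∀ x y z, Strict r x y → Strict r y z →
    ∃ t s : Set.Icc (0 : ℝ) 1, (t : ℝ) ∈ Set.Ioo (0 : ℝ) 1 ∧ (s : ℝ) ∈ Set.Ioo (0 : ℝ) 1 ∧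
      Strict r (mixC hX t x z) y ∧ Strict r y (mixC hX s x z)
  nontrivial : ∃ x y, Strict r x y

namespace IsVNM

variable {hX : Convex ℝ X} {r : X → X → Prop}

theorem refl (h : IsVNM hX r) (x : X) : r x x := (h.total x x).elim id id

theorem of_not (h : IsVNM hX r) {x y : X} (hxy : ¬ r x y) : r y x :=
  (h.total x y).resolve_left hxy

theorem mix_left (h : IsVNM hX r) {x y : X} (hxy : r x y) (z : X) (t : Set.Icc (0 : ℝ) 1) :
    r (mixC hX t x z) (mixC hX t y z) := by
  rcases t.2.1.eq_or_lt with ht | ht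
  · rw [mixC_zero hX ht.symm, mixC_zero hX ht.symm]
    exact h.refl z
  · exact (h.indep x y z t ht).1 hxy

theorem mix_right (h : IsVNM hX r) {x y : X} (hxy : r x y) (z : X) (t : Set.Icc (0 : ℝ) 1) :
    r (mixC hX t z x) (mixC hX t z y) := by
  rw [← mixC_symm hX t x z, ← mixC_symm hX t y z]
  exact h.mix_left hxy z _

/-- The cone generated by the differences `x - y` with `r x y`. -/
def cone (h : IsVNM hX r) : PointedCone ℝ E where
  carrier := {v | ∃ l : ℝ, 0 ≤ l ∧ ∃ x y : X, r x y ∧ v = l • ((x : E) - y)}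
  zero_mem' := by
    obtain ⟨x, -, -⟩ := h.nontrivial
    exact ⟨0, le_rfl, x, x, h.refl x, by simp⟩
  smul_mem' := by
    rintro c _ ⟨l, hl, x, y, hxy, rfl⟩
    refine ⟨c * l, mul_nonneg c.2 hl, x, y, hxy, ?_⟩
    rw [mul_smul]
    rfl
  add_mem' := by
    rintro _ _ ⟨l, hl, x, y, hxy, rfl⟩ ⟨m, hm, x', y', hxy', rfl⟩
    rcases (add_nonneg hl hm).eq_or_lt with h0 | h0
    · have hl0 : l = 0 := by linarith
      have hm0 : m = 0 := by linarith
      exact ⟨0, le_rfl, x, y, hxy, by simp [hl0, hm0]⟩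
    · let t : Set.Icc (0 : ℝ) 1 := ⟨l / (l + m), by positivity, by
        rw [div_le_one h0]; linarith⟩
      have ht : (t : ℝ) = l / (l + m) := rfl
      refine ⟨l + m, h0.le, mixC hX t x x', mixC hX t y y',
        h.trans _ _ _ (h.mix_left hxy x' t) (h.mix_right hxy' y t), ?_⟩
      have h1 : (l + m) * (t : ℝ) = l := by rw [ht]; field_simp
      have h2 : (l + m) * (1 - (t : ℝ)) = m := by rw [mul_sub, h1]; ring
      have : (l + m) • ((mixC hX t x x' : E) - mixC hX t y y')
          = ((l + m) * (t : ℝ)) • ((x : E) - y) + ((l + m) * (1 - (t : ℝ))) • ((x' : E) - y') := by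
        simp only [coe_mixC]
        module
      rw [this, h1, h2]

theorem mem_cone_of_rel (h : IsVNM hX r) {x y : X} (hxy : r x y) : (x : E) - y ∈ h.cone :=
  ⟨1, zero_le_one, x, y, hxy, by simp⟩

theorem smul_mem_cone (h : IsVNM hX r) {c : ℝ} (hc : 0 ≤ c) {v : E} (hv : v ∈ h.cone) :
    c • v ∈ h.cone := h.cone.smul_mem hc hv

/-- If x − y = l(x' − y'), the weight 1/(1 + l) on x and y makes the mixture of x with y' coincide
with that of y with x'. Independence then reduces the claim to `r x' y'`. -/
theorem rel_of_mem_cone (h : IsVNM hX r) {x y : X} (hxy : (x : E) - y ∈ h.cone) : r x y := by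
  obtain ⟨l, hl, x', y', hr, he⟩ := hxy
  have h0 : 0 < 1 + l := by linarith
  let t : Set.Icc (0 : ℝ) 1 := ⟨1 / (1 + l), by positivity, by
    rw [div_le_one h0]; linarith⟩
  have ht : (t : ℝ) = 1 / (1 + l) := rfl
  have ht0 : 0 < (t : ℝ) := by rw [ht]; positivity
  have hl' : 1 - (t : ℝ) = (t : ℝ) * l := by rw [ht]; field_simp; ring
  have key : mixC hX t x y' = mixC hX t y x' := by
    apply Subtype.ext
    have hx : (x : E) = y + l • ((x' : E) - y') := by rw [← he]; abel
    simp only [coe_mixC, hl', hx]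
    module
  rw [h.indep x y y' t ht0, key]
  exact h.mix_right hr y t

/-- The archimedean axiom makes a strict difference x − y an order unit. Write z − w = (z − y) + (x
− w) − (x − y) and dominate the first two terms separately. -/
theorem exists_smul_sub_mem_cone (h : IsVNM hX r) {x y : X} (hxy : Strict r x y) {v : E}
    (hv : v ∈ h.cone) : ∃ c : ℝ, 0 ≤ c ∧ c • ((x : E) - y) - v ∈ h.cone := by
  obtain ⟨l, hl, z, w, hzw, rfl⟩ := hv
  have h1 : ∃ c : ℝ, 0 ≤ c ∧ c • ((x : E) - y) - ((z : E) - y) ∈ h.cone := by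
    by_cases hxz : r x z
    · exact ⟨1, zero_le_one, by simpa using h.mem_cone_of_rel hxz⟩
    · obtain ⟨-, s, -, hs, -, hlt⟩ := h.archimedean z x y ⟨h.of_not hxz, hxz⟩ hxy
      have hs0 := hs.1
      refine ⟨(s : ℝ)⁻¹, by positivity, ?_⟩
      have := h.smul_mem_cone (c := (s : ℝ)⁻¹) (by positivity) (h.mem_cone_of_rel hlt.1)
      convert this using 1
      rw [coe_mixC]
      match_scalars <;> field_simp
      ring
  have h2 : ∃ c : ℝ, 0 ≤ c ∧ c • ((x : E) - y) - ((x : E) - w) ∈ h.cone := by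
    by_cases hwy : r w y
    · exact ⟨1, zero_le_one, by simpa using h.mem_cone_of_rel hwy⟩
    · obtain ⟨t, -, ht, -, hlt, -⟩ := h.archimedean x y w hxy ⟨h.of_not hwy, hwy⟩
      have ht1 : 0 < 1 - (t : ℝ) := sub_pos.2 ht.2
      refine ⟨(1 - (t : ℝ))⁻¹, by positivity, ?_⟩
      have := h.smul_mem_cone (c := (1 - (t : ℝ))⁻¹) (by positivity) (h.mem_cone_of_rel hlt.1)
      convert this using 1
      rw [coe_mixC]
      match_scalars <;> field_simp
      ring
  obtain ⟨a, ha, hac⟩ := h1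
  obtain ⟨b, hb, hbc⟩ := h2
  refine ⟨l * (a + b), by positivity, ?_⟩
  have h3 := h.smul_mem_cone hl
    (h.cone.add_mem (h.cone.add_mem hac hbc) (h.mem_cone_of_rel hxy.1))
  convert h3 using 1
  module

/-- M. Riesz extension from the line through x₁ − x₀, carried out in the span `L` of the cone
because the order unit absorbs only that span; outside `L` any linear extension will do. Strict
differences are order units too, hence get positive values. -/
theorem exists_linear (h : IsVNM hX r) :
    ∃ g : E →ₗ[ℝ] ℝ, ∀ x y : X, r x y ↔ g y ≤ g x := by
  obtain ⟨x₁, x₀, h10⟩ := h.nontrivial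
  let L : Submodule ℝ E :=
    { carrier := {v | ∃ a ∈ h.cone, ∃ b ∈ h.cone, v = a - b}
      zero_mem' := ⟨0, h.cone.zero_mem, 0, h.cone.zero_mem, by simp⟩
      add_mem' := by
        rintro _ _ ⟨a, ha, b, hb, rfl⟩ ⟨a', ha', b', hb', rfl⟩
        exact ⟨a + a', h.cone.add_mem ha ha', b + b', h.cone.add_mem hb hb', by abel⟩
      smul_mem' := by
        rintro c _ ⟨a, ha, b, hb, rfl⟩
        rcases le_total 0 c with hc | hc
        · exact ⟨c • a, h.smul_mem_cone hc ha, c • b, h.smul_mem_cone hc hb, smul_sub _ _ _⟩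
        · refine ⟨(-c) • b, h.smul_mem_cone (neg_nonneg.2 hc) hb, (-c) • a,
            h.smul_mem_cone (neg_nonneg.2 hc) ha, ?_⟩
          module }
  have hL : ∀ v ∈ h.cone, v ∈ L := fun v hv => ⟨v, hv, 0, h.cone.zero_mem, by simp⟩
  let s : PointedCone ℝ L := h.cone.comap L.subtype
  let e : L := ⟨(x₁ : E) - x₀, hL _ (h.mem_cone_of_rel h10.1)⟩
  have he : e ≠ 0 := by
    intro he
    have : (x₁ : E) - x₀ = 0 := congrArg Subtype.val he
    apply h10.2
    rw [Subtype.ext (sub_eq_zero.1 this)]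
    exact h.refl _
  obtain ⟨g, hg1, hg2⟩ := riesz_extension s (LinearPMap.mkSpanSingleton e (1 : ℝ) he)
    (by
      rintro ⟨_, hv⟩ hs
      obtain ⟨c, rfl⟩ := Submodule.mem_span_singleton.1 hv
      change 0 ≤ LinearPMap.mkSpanSingleton' e (1 : ℝ) _ _
      rw [LinearPMap.mkSpanSingleton'_apply]
      by_contra! hc
      have hc' : c < 0 := by simpa using hc
      apply h10.2
      apply h.rel_of_mem_cone
      have := h.smul_mem_cone (c := (-c)⁻¹) (by have := neg_pos.2 hc'; positivity)
        (show ((c • e : L) : E) ∈ h.cone from hs)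
      convert this using 1
      rw [Submodule.coe_smul, smul_smul]
      have : (-c)⁻¹ * c = -1 := by rw [inv_neg, neg_mul, inv_mul_cancel₀ hc'.ne]
      rw [this]
      change _ = (-1 : ℝ) • ((x₁ : E) - x₀)
      module)
    (by
      rintro ⟨_, a, ha, b, hb, rfl⟩
      obtain ⟨c, -, hc⟩ := h.exists_smul_sub_mem_cone h10 hb
      refine ⟨⟨c • e, Submodule.smul_mem _ _ (Submodule.mem_span_singleton_self e)⟩, ?_⟩
      change c • ((x₁ : E) - x₀) + (a - b) ∈ h.cone
      have := h.cone.add_mem hc ha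
      convert this using 1
      abel)
  have hge : g e = 1 := by
    have := hg1 ⟨e, Submodule.mem_span_singleton_self e⟩
    rw [LinearPMap.mkSpanSingleton_apply] at this
    exact this
  obtain ⟨G, hG⟩ := LinearMap.exists_extend g
  have hGL : ∀ v (hv : v ∈ L), G v = g ⟨v, hv⟩ := fun v hv => by rw [← hG]; rfl
  have hpos : ∀ v ∈ h.cone, 0 ≤ G v := fun v hv => by
    rw [hGL v (hL v hv)]
    exact hg2 _ hv
  have hG1 : G ((x₁ : E) - x₀) = 1 := by
    rw [hGL _ (hL _ (h.mem_cone_of_rel h10.1))]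
    exact hge
  refine ⟨G, fun x y => ⟨fun hxy => ?_, fun hle => ?_⟩⟩
  · have := hpos _ (h.mem_cone_of_rel hxy)
    rw [map_sub] at this
    linarith
  · by_contra hxy
    obtain ⟨c, hc0, hc⟩ := h.exists_smul_sub_mem_cone ⟨h.of_not hxy, hxy⟩
      (h.mem_cone_of_rel h10.1)
    have := hpos _ hc
    rw [map_sub, hG1, map_smul, map_sub, smul_eq_mul] at this
    nlinarith

end IsVNM

/-! ### The certainty equivalent functional -/

namespace ConditionalMEUAt

variable {hX : Convex ℝ X} {R RA : (S → X) → (S → X) → Prop} {A : Set S}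

theorem refl (H : ConditionalMEUAt hX R A RA) (f : S → X) : RA f f :=
  (H.complete f f).elim id id

theorem of_not (H : ConditionalMEUAt hX R A RA) {f g : S → X} (h : ¬ RA f g) : RA g f :=
  (H.complete f g).resolve_left h

theorem isVNM (H : ConditionalMEUAt hX R A RA) :
    IsVNM hX fun x y => RA (cst S x) (cst S y) where
  total x y := H.complete _ _
  trans x y z := H.transitive _ _ _
  indep x y z t ht := H.certainty_independence (cst S x) (cst S y) z t ht
  archimedean x y z := H.continuity (cst S x) (cst S y) (cst S z)
  nontrivial := by
    -- Were all constants indifferent, monotonicity would make all acts indifferent.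
    by_contra! hn
    obtain ⟨f, g, hfg⟩ := H.nondegeneracy
    refine hfg.2 (H.monotonicity g f fun s _ => ?_)
    by_contra hs
    exact hn (f s) (g s) ⟨H.of_not hs, hs⟩

end ConditionalMEUAt

/-- Affine functions on a convex set of consequences. -/
def IsAffine (hX : Convex ℝ X) (u : X → ℝ) : Prop :=
  ∀ (x y : X) (t : Set.Icc (0 : ℝ) 1),
    u (mixC hX t x y) = (t : ℝ) * u x + (1 - (t : ℝ)) * u y

theorem mixC_mixC_left (hX : Convex ℝ X) (t s : Set.Icc (0 : ℝ) 1) (x y : X) :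
    mixC hX t (mixC hX s x y) y = mixC hX (t * s) x y := by
  apply Subtype.ext
  simp only [coe_mixC, Set.Icc.coe_mul]
  module

theorem mixC_mixC_right (hX : Convex ℝ X) (t s : Set.Icc (0 : ℝ) 1) (x y : X) :
    mixC hX t x (mixC hX s x y)
      = mixC hX (unitInterval.symm (unitInterval.symm t * unitInterval.symm s)) x y := by
  apply Subtype.ext
  simp only [coe_mixC, Set.Icc.coe_mul, unitInterval.coe_symm_eq]
  module

/-- The certainty equivalent sits at the supremum c of the weights on x whose mixture is no better
than f. By continuity a strict preference there survives some move of the weight towards y or x,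
contradicting the supremum unless c is 0 or 1, where the mixture is y or x itself. -/
theorem ConditionalMEUAt.exists_indiff_cst_of_between {hX : Convex ℝ X}
    {R RA : (S → X) → (S → X) → Prop} {A : Set S} (H : ConditionalMEUAt hX R A RA)
    {u : X → ℝ} (hu : IsAffine hX u)
    (hrep : ∀ x y, RA (cst S x) (cst S y) ↔ u y ≤ u x) {f : S → X} {x y : X}
    (hxf : RA (cst S x) f) (hfy : RA f (cst S y)) : ∃ z, Indiff RA f (cst S z) := by
  by_cases hfx : RA f (cst S x)
  · exact ⟨x, hfx, hxf⟩
  by_cases hyf : RA (cst S y) f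
  · exact ⟨y, hfy, hyf⟩
  have hxy : u y ≤ u x := (hrep x y).1 (H.transitive _ _ _ hxf hfy)
  let T : Set ℝ := {c | ∃ t : Set.Icc (0 : ℝ) 1, (t : ℝ) = c ∧ RA f (cst S (mixC hX t x y))}
  have hT1 : ∀ c ∈ T, c ≤ 1 := by
    rintro _ ⟨t, rfl, -⟩
    exact t.2.2
  have hTb : BddAbove T := ⟨1, hT1⟩
  have hT0 : (0 : ℝ) ∈ T := ⟨⟨0, by simp⟩, rfl, by rwa [mixC_zero hX rfl]⟩
  let c : Set.Icc (0 : ℝ) 1 := ⟨sSup T, le_csSup hTb hT0, csSup_le ⟨0, hT0⟩ hT1⟩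
  have hcT : (c : ℝ) = sSup T := rfl
  have hone : (c : ℝ) = 1 → mixC hX c x y = x := fun h => by
    apply Subtype.ext
    simp [coe_mixC, h]
  refine ⟨mixC hX c x y, ?_, ?_⟩
  · by_contra hfz
    obtain ⟨t, -, ht, -, hlt, -⟩ := H.continuity (cst S (mixC hX c x y)) f (cst S y)
      ⟨H.of_not hfz, hfz⟩ ⟨hfy, hyf⟩
    rw [mix_cst, mixC_mixC_left] at hlt
    have hle : (c : ℝ) ≤ (t : ℝ) * c := by
      refine csSup_le ⟨0, hT0⟩ ?_
      rintro _ ⟨s, rfl, hs⟩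
      by_contra! hlt'
      refine hlt.2 (H.transitive _ _ _ hs ((hrep _ _).2 ?_))
      rw [hu, hu, Set.Icc.coe_mul]
      nlinarith
    have hc0 : (c : ℝ) = 0 := by nlinarith [c.2.1, ht.2]
    rw [mixC_zero hX hc0] at hfz
    exact hfz hfy
  · by_contra hzf
    obtain ⟨-, t, -, ht, -, hlt⟩ := H.continuity (cst S x) f (cst S (mixC hX c x y))
      ⟨hxf, hfx⟩ ⟨H.of_not hzf, hzf⟩
    rw [mix_cst, mixC_mixC_right] at hlt
    have hle : 1 - (1 - (t : ℝ)) * (1 - (c : ℝ)) ≤ c := by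
      refine le_csSup hTb ⟨_, ?_, hlt.1⟩
      simp only [unitInterval.coe_symm_eq, Set.Icc.coe_mul]
    have hc1 : (c : ℝ) = 1 := by nlinarith [c.2.2, ht.1]
    rw [hone hc1] at hzf
    exact hzf hxf

theorem ConditionalMEUAt.exists_indiff_cst [Finite S] {hX : Convex ℝ X}
    {R RA : (S → X) → (S → X) → Prop} {A : Set S} (H : ConditionalMEUAt hX R A RA)
    (hA : A.Nonempty) {u : X → ℝ} (hu : IsAffine hX u)
    (hrep : ∀ x y, RA (cst S x) (cst S y) ↔ u y ≤ u x) (f : S → X) :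
    ∃ z, Indiff RA f (cst S z) := by
  obtain ⟨s₁, -, h1⟩ := Set.exists_max_image A (fun s => u (f s)) A.toFinite hA
  obtain ⟨s₀, -, h0⟩ := Set.exists_min_image A (fun s => u (f s)) A.toFinite hA
  exact H.exists_indiff_cst_of_between hu hrep (x := f s₁) (y := f s₀)
    (H.monotonicity _ _ fun s hs => (hrep _ _).2 (h1 s hs))
    (H.monotonicity _ _ fun s hs => (hrep _ _).2 (h0 s hs))

/-- A functional on acts that extends the utility `u`, is affine in mixtures with constant acts,
concave, and monotone in the utilities obtained on `A`. -/
structure IsMaxminFunctional (hX : Convex ℝ X) (A : Set S) (u : X → ℝ) (V : (S → X) → ℝ) :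
    Prop where
  cst : ∀ x, V (cst S x) = u x
  mix_cst : ∀ (f : S → X) (x : X) (t : Set.Icc (0 : ℝ) 1),
    V (mix hX t f (PBU.cst S x)) = (t : ℝ) * V f + (1 - (t : ℝ)) * u x
  concave : ∀ (f g : S → X) (t : Set.Icc (0 : ℝ) 1),
    (t : ℝ) * V f + (1 - (t : ℝ)) * V g ≤ V (mix hX t f g)
  mono : ∀ f g, (∀ s ∈ A, u (g s) ≤ u (f s)) → V g ≤ V f

theorem IsMaxminFunctional.congr {hX : Convex ℝ X} {A : Set S} {u : X → ℝ} {V : (S → X) → ℝ}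
    (h : IsMaxminFunctional hX A u V) {f g : S → X} (hfg : ∀ s ∈ A, u (f s) = u (g s)) :
    V f = V g :=
  le_antisymm (h.mono _ _ fun s hs => (hfg s hs).le) (h.mono _ _ fun s hs => (hfg s hs).ge)

theorem ConditionalMEUAt.exists_functional [Finite S] {hX : Convex ℝ X}
    {R RA : (S → X) → (S → X) → Prop} {A : Set S} (H : ConditionalMEUAt hX R A RA)
    (hA : A.Nonempty) {u : X → ℝ} (hu : IsAffine hX u)
    (hrep : ∀ x y, RA (cst S x) (cst S y) ↔ u y ≤ u x) :
    ∃ V : (S → X) → ℝ, IsMaxminFunctional hX A u V ∧ ∀ f g, RA f g ↔ V g ≤ V f := by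
  choose ce hce using H.exists_indiff_cst hA hu hrep
  have hV : ∀ f g, RA f g ↔ u (ce g) ≤ u (ce f) := fun f g => by
    rw [← hrep]
    exact ⟨fun h => H.transitive _ _ _ (hce f).2 (H.transitive _ _ _ h (hce g).1),
      fun h => H.transitive _ _ _ (hce f).1 (H.transitive _ _ _ h (hce g).2)⟩
  have hVcst : ∀ x, u (ce (cst S x)) = u x := fun x =>
    le_antisymm ((hrep _ _).1 (hce _).1) ((hrep _ _).1 (hce _).2)
  have hmono : ∀ f g : S → X, (∀ s ∈ A, u (g s) ≤ u (f s)) → u (ce g) ≤ u (ce f) := fun f g h =>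
    (hV f g).1 (H.monotonicity _ _ fun s hs => (hrep _ _).2 (h s hs))
  have hcongr : ∀ f g : S → X, (∀ s ∈ A, u (f s) = u (g s)) → u (ce f) = u (ce g) := fun f g h =>
    le_antisymm (hmono _ _ fun s hs => (h s hs).le) (hmono _ _ fun s hs => (h s hs).ge)
  have hmix : ∀ (f : S → X) x (t : Set.Icc (0 : ℝ) 1),
      u (ce (mix hX t f (cst S x))) = (t : ℝ) * u (ce f) + (1 - (t : ℝ)) * u x := by
    intro f x t
    rw [← hu, ← hVcst (mixC hX t (ce f) x), ← mix_cst]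
    rcases t.2.1.eq_or_lt with ht | ht
    · refine hcongr _ _ fun s _ => ?_
      simp only [mix]
      rw [mixC_zero hX ht.symm, mixC_zero hX ht.symm]
    · exact le_antisymm
        ((hV _ _).1 ((H.certainty_independence _ _ x t ht).1 (hce f).2))
        ((hV _ _).1 ((H.certainty_independence _ _ x t ht).1 (hce f).1))
  refine ⟨fun f => u (ce f), ⟨hVcst, hmix, fun f g t => ?_, hmono⟩, hV⟩
  -- Mixing f and g half and half with each other's certainty equivalent gives two indifferent acts,
  -- to which ambiguity aversion applies; cancelling the constant part leaves concavity.
  let k : Set.Icc (0 : ℝ) 1 := ⟨1 / 2, by norm_num, by norm_num⟩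
  have hk : (k : ℝ) = 1 / 2 := rfl
  have hF := hmix f (ce g) k
  have hG := hmix g (ce f) k
  have hFG : Indiff RA (mix hX k f (cst S (ce g))) (mix hX k g (cst S (ce f))) := by
    constructor <;> rw [hV, hF, hG, hk] <;> linarith
  have h1 := (hV _ _).1 (H.ambiguity_aversion _ _ hFG t)
  rw [hcongr (mix hX t (mix hX k f (cst S (ce g))) (mix hX k g (cst S (ce f))))
    (mix hX k (mix hX t f g) (cst S (mixC hX t (ce g) (ce f)))) fun s _ => by
      simp only [mix, cst]
      rw [hu, hu, hu, hu, hu, hu, hk]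
      ring, hF, hmix, hu, hk] at h1
  linarith

variable [Fintype S]

/-! ### Supporting probabilities -/

theorem IsAffine.exists_mid {hX : Convex ℝ X} {u : X → ℝ} (hu : IsAffine hX u) (x y : X) :
    ∃ m, u m = (u x + u y) / 2 :=
  ⟨mixC hX ⟨1 / 2, by norm_num, by norm_num⟩ x y, by rw [hu]; ring⟩

/-- Utilities may be bounded, so a direction `a` is realized only after shrinking by η. The summand
1 in `N` covers `a = 0`. -/
theorem IsAffine.exists_act {hX : Convex ℝ X} {u : X → ℝ} (hu : IsAffine hX u) {x₀ x₁ : X}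
    (h01 : u x₀ < u x₁) (a : S → ℝ) :
    ∃ η : ℝ, 0 < η ∧ ∃ h : S → X, ∀ s, u (h s) = (u x₁ + u x₀) / 2 + η * a s := by
  set N : ℝ := 1 + ∑ s, |a s| with hN
  have hN0 : 0 < N := by positivity
  have habs : ∀ s, |a s| ≤ N := fun s => by
    have := Finset.single_le_sum (f := fun s => |a s|) (fun i _ => abs_nonneg _)
      (Finset.mem_univ s)
    linarith
  have ht : ∀ s, 1 / 2 + a s / (2 * N) ∈ Set.Icc (0 : ℝ) 1 := fun s => by
    have h1 : |a s / (2 * N)| ≤ 1 / 2 := by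
      rw [abs_div, abs_of_pos (by positivity : 0 < 2 * N), div_le_iff₀ (by positivity)]
      linarith [habs s]
    have := abs_le.1 h1
    constructor <;> linarith
  refine ⟨(u x₁ - u x₀) / (2 * N), div_pos (sub_pos.2 h01) (by positivity),
    fun s => mixC hX ⟨_, ht s⟩ x₁ x₀, fun s => ?_⟩
  rw [hu]
  field_simp
  ring

/-- Jensen's inequality in both directions, for the extension of u to E by a junk value 0. -/
theorem IsAffine.map_reduceC {hX : Convex ℝ X} {u : X → ℝ} (hu : IsAffine hX u)
    (α : stdSimplex ℝ S) (f : S → X) :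
    u (reduceC hX α f) = ∑ s, u (f s) * (α : S → ℝ) s := by
  classical
  let v : E → ℝ := fun e => if h : e ∈ X then u ⟨e, h⟩ else 0
  have hv : ∀ x : X, v x = u x := fun x => by simp [v]
  have key : ∀ ⦃x : E⦄, x ∈ X → ∀ ⦃y : E⦄, y ∈ X → ∀ ⦃a b : ℝ⦄, 0 ≤ a → 0 ≤ b → a + b = 1 →
      v (a • x + b • y) = a • v x + b • v y := by
    intro x hx y hy a b ha hb hab
    obtain rfl : b = 1 - a := by linarith
    have := hu ⟨x, hx⟩ ⟨y, hy⟩ ⟨a, ha, by linarith⟩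
    rw [← hv, ← hv, ← hv] at this
    exact this
  have h1 : ConvexOn ℝ X v := ⟨hX, fun x hx y hy a b ha hb hab => (key hx hy ha hb hab).le⟩
  have h2 : ConcaveOn ℝ X v := ⟨hX, fun x hx y hy a b ha hb hab => (key hx hy ha hb hab).ge⟩
  have h3 := le_antisymm
    (h1.map_sum_le (t := Finset.univ) (fun i _ => α.2.1 i) α.2.2 fun i _ => (f i).2)
    (h2.le_map_sum (t := Finset.univ) (fun i _ => α.2.1 i) α.2.2 fun i _ => (f i).2)
  rw [← hv]
  refine h3.trans (Finset.sum_congr rfl fun s _ => ?_)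
  rw [hv, smul_eq_mul, mul_comm]
  rfl

theorem sum_mul_const_add {π : S → ℝ} (hπ : π ∈ stdSimplex ℝ S) (k η : ℝ) (b : S → ℝ) :
    ∑ s, (k + η * b s) * π s = k + η * ∑ s, b s * π s := by
  simp only [add_mul, Finset.sum_add_distrib, mul_assoc, ← Finset.mul_sum, hπ.2, mul_one]

/-- A superlinear functional on `S → ℝ` that is nonnegative on nonnegative functions and normalized
on constants is supported at every point by a probability. -/
theorem exists_support_of_superlinear {J : (S → ℝ) → ℝ}
    (hom : ∀ c : ℝ, 0 < c → ∀ a, J (c • a) = c * J a) (superadd : ∀ a b, J a + J b ≤ J (a + b))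
    (nonneg : ∀ a, (∀ s, 0 ≤ a s) → 0 ≤ J a) (const : ∀ c : ℝ, J (fun _ => c) = c)
    (a : S → ℝ) :
    ∃ π ∈ stdSimplex ℝ S, (∀ b, J b ≤ ∑ s, b s * π s) ∧ J a = ∑ s, a s * π s := by
  classical
  have J0 : J 0 = 0 := const 0
  have H : ∀ c : ℝ, c • a = 0 → (RingHom.id ℝ) c • J a = 0 := fun c hc => by
    rcases smul_eq_zero.1 hc with h | h
    · simp [h]
    · simp [h, J0]
  -- The majorant −J(−b) is sublinear, and being below it is the same as being above J.
  obtain ⟨g, hg1, hg2⟩ := exists_extension_of_le_sublinear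
    (LinearPMap.mkSpanSingleton' a (J a) H) (fun b => -J (-b))
    (fun c hc x => by rw [← smul_neg, hom c hc]; ring)
    (fun x y => by have := superadd (-x) (-y); rw [neg_add]; linarith)
    (by
      rintro ⟨_, hv⟩
      obtain ⟨c, rfl⟩ := Submodule.mem_span_singleton.1 hv
      rw [LinearPMap.mkSpanSingleton'_apply]
      change c * J a ≤ -J (-(c • a))
      rcases lt_trichotomy c 0 with hc | rfl | hc
      · rw [← neg_smul, hom (-c) (neg_pos.2 hc)]
        linarith
      · simp [J0]
      · rw [← smul_neg, hom c hc]
        have := superadd a (-a)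
        rw [add_neg_cancel, J0] at this
        nlinarith)
  have hga : g a = J a := by
    have := hg1 ⟨a, Submodule.mem_span_singleton_self a⟩
    rw [this]
    have h1 := LinearPMap.mkSpanSingleton'_apply a (J a) H 1
      (by rw [one_smul]; exact Submodule.mem_span_singleton_self a)
    simpa using h1
  have hge : ∀ b, J b ≤ g b := fun b => by
    have := hg2 (-b)
    rw [neg_neg, map_neg] at this
    linarith
  have hsum : ∀ b, g b = ∑ s, b s * g (Pi.single s 1) := fun b => by
    rw [LinearMap.pi_apply_eq_sum_univ g b]
    refine Finset.sum_congr rfl fun s _ => ?_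
    rw [smul_eq_mul]
    congr 2
    ext j
    simp [Pi.single_apply, eq_comm]
  refine ⟨fun s => g (Pi.single s 1), ⟨fun s => ?_, ?_⟩, fun b => (hge b).trans (hsum b).le,
    hga.symm.trans (hsum a)⟩
  · refine (nonneg _ fun j => ?_).trans (hge _)
    by_cases h : j = s <;> simp [h]
  · have h1 := hsum fun _ => 1
    simp only [one_mul] at h1
    rw [← h1]
    apply le_antisymm
    · have h2 := hg2 fun _ => 1
      have h3 : (-fun _ : S => (1 : ℝ)) = fun _ => -1 := rfl
      rw [h3, const] at h2
      linarith
    · have h2 := hge fun _ => 1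
      rwa [const] at h2

/-- Mixing with a constant of utility k rescales profiles about k. Hence V − k is positively
homogeneous in u ∘ f − k and extends to a superlinear `J` on all of S → ℝ. -/
theorem IsMaxminFunctional.exists_support [Nonempty S] {hX : Convex ℝ X} {A : Set S} {u : X → ℝ}
    {V : (S → X) → ℝ} (h : IsMaxminFunctional hX A u V) (hu : IsAffine hX u) {x₀ x₁ : X}
    (h01 : u x₀ < u x₁) (f : S → X) :
    ∃ π ∈ stdSimplex ℝ S, (∀ g : S → X, V g ≤ ∑ s, u (g s) * π s) ∧
      V f = ∑ s, u (f s) * π s := by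
  obtain ⟨m, hm⟩ := hu.exists_mid x₁ x₀
  set k := (u x₁ + u x₀) / 2 with hk
  have shrink : ∀ (f g : S → X) (l : ℝ), 0 < l → l ≤ 1 →
      (∀ s, u (f s) - k = l * (u (g s) - k)) → V f - k = l * (V g - k) := by
    intro f g l hl hl1 hfg
    have h1 := h.mix_cst g m ⟨l, hl.le, hl1⟩
    rw [← h.congr (f := f) fun s _ => by
      simp only [mix, PBU.cst]
      rw [hu, hm]
      linarith [hfg s], hm] at h1
    simp only at h1
    linarith
  have scale : ∀ (f g : S → X) (l : ℝ), 0 < l →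
      (∀ s, u (f s) - k = l * (u (g s) - k)) → V f - k = l * (V g - k) := by
    intro f g l hl hfg
    rcases le_total l 1 with hl1 | hl1
    · exact shrink f g l hl hl1 hfg
    · have := shrink g f l⁻¹ (by positivity) (inv_le_one_of_one_le₀ hl1) fun s => by
        rw [hfg s, inv_mul_cancel_left₀ hl.ne']
      rw [this, mul_inv_cancel_left₀ hl.ne']
  choose η hη act hact using fun a : S → ℝ => hu.exists_act (S := S) h01 a
  let J : (S → ℝ) → ℝ := fun a => (V (act a) - k) / η a
  have hJ : ∀ (a : S → ℝ) (l : ℝ) (g : S → X), 0 < l → (∀ s, u (g s) = k + l * a s) →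
      V g = k + l * J a := by
    intro a l g hl hg
    have h0 := hη a
    have := scale g (act a) (l / η a) (div_pos hl h0) fun s => by
      rw [hg s, hact a s]
      field_simp
      ring
    simp only [J]
    rw [← sub_eq_iff_eq_add', this]
    ring
  obtain ⟨π, hπ, hle, heq⟩ := exists_support_of_superlinear (J := J)
    (fun c hc a => by
      have h0 := hη (c • a)
      have h1 := hJ (c • a) _ _ h0 (hact (c • a))
      have h2 := hJ a (η (c • a) * c) _ (by positivity) fun s => by
        rw [hact (c • a) s]
        simp [mul_assoc, k]
      have h3 : η (c • a) * J (c • a) = η (c • a) * (c * J a) := by linarith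
      exact mul_left_cancel₀ h0.ne' h3)
    (fun a b => by
      have ha := hη a
      have hb := hη b
      -- This weight equalizes the two scales, so the mixture is a realization of `a + b`.
      let t : Set.Icc (0 : ℝ) 1 := ⟨η b / (η a + η b), by positivity, by
        rw [div_le_one (by positivity)]; linarith⟩
      have ht : (t : ℝ) = η b / (η a + η b) := rfl
      have ht' : (1 - (t : ℝ)) * η b = t * η a := by rw [ht]; field_simp; ring
      have ht0 : 0 < (t : ℝ) * η a := by rw [ht]; positivity
      have h1 := hJ (a + b) (t * η a) (mix hX t (act a) (act b)) ht0 fun s => by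
        simp only [mix]
        rw [hu, hact, hact, Pi.add_apply]
        linear_combination b s * ht'
      have h2 := h.concave (act a) (act b) t
      rw [h1, hJ a _ _ ha (hact a), hJ b _ _ hb (hact b)] at h2
      have h3 : (t : ℝ) * η a * (J a + J b) ≤ t * η a * J (a + b) := by
        have : (1 - (t : ℝ)) * (η b * J b) = t * η a * J b := by rw [← ht']; ring
        nlinarith
      exact le_of_mul_le_mul_left h3 ht0)
    (fun a ha => by
      have h0 := hη a
      have h1 := h.mono (act a) (PBU.cst S m) fun s _ => by
        rw [hact, PBU.cst, hm]
        have := mul_nonneg h0.le (ha s)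
        linarith
      rw [h.cst, hm] at h1
      exact div_nonneg (by linarith) h0.le)
    (fun c => by
      let s₀ : S := Classical.arbitrary S
      have h1 : V (act fun _ => c) = u (act (fun _ => c) s₀) := by
        rw [← h.cst]
        refine h.congr fun s _ => ?_
        rw [PBU.cst, hact, hact]
      have h0 := hη fun _ => c
      simp only [J]
      rw [h1, hact]
      simp only [k]
      field_simp
      ring)
    (fun s => u (f s) - k)
  have hsum : ∀ g : S → X, ∑ s, u (g s) * π s = k + ∑ s, (u (g s) - k) * π s := fun g => by
    have := sum_mul_const_add hπ k 1 fun s => u (g s) - k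
    simpa using this
  have hVJ : ∀ g : S → X, V g = k + J fun s => u (g s) - k := fun g => by
    have := hJ (fun s => u (g s) - k) 1 g one_pos fun s => by ring
    simpa using this
  refine ⟨π, hπ, fun g => ?_, ?_⟩
  · rw [hsum, hVJ]
    have := hle fun s => u (g s) - k
    linarith
  · rw [hsum, hVJ, heq]

/-! ### Maxmin representations -/

/-- The probabilities that are acceptable reductions for `R`. -/
def acceptable (hX : Convex ℝ X) (R : (S → X) → (S → X) → Prop) : Set (S → ℝ) :=
  {α | ∃ h : α ∈ stdSimplex ℝ S, PrefersReduction hX R ⟨α, h⟩}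

theorem isMEURep_acceptable [Nonempty S] {hX : Convex ℝ X} {A : Set S} {u : X → ℝ}
    {V : (S → X) → ℝ} {R : (S → X) → (S → X) → Prop} (h : IsMaxminFunctional hX A u V)
    (hu : IsAffine hX u) {x₀ x₁ : X} (h01 : u x₀ < u x₁) (hR : ∀ f g, R f g ↔ V g ≤ V f) :
    IsMEURep hX u (acceptable hX R) R ∧ ∀ α ∈ acceptable hX R, ∀ s, s ∉ A → α s = 0 := by
  have hmem : ∀ α, α ∈ acceptable hX R ↔
      α ∈ stdSimplex ℝ S ∧ ∀ f : S → X, V f ≤ ∑ s, u (f s) * α s := fun α => by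
    refine ⟨fun ⟨hα, hp⟩ => ⟨hα, fun f => ?_⟩, fun ⟨hα, hp⟩ => ⟨hα, fun f => ?_⟩⟩
    · have := (hR _ _).1 (hp f)
      rwa [reduce, h.cst, hu.map_reduceC] at this
    · rw [hR, reduce, h.cst, hu.map_reduceC]
      exact hp f
  have hset : acceptable hX R =
      stdSimplex ℝ S ∩ ⋂ f : S → X, {α | V f ≤ ∑ s, u (f s) * α s} := by
    ext α
    simp [hmem]
  have hval : ∀ f, meuValue u (acceptable hX R) f = V f := fun f => by
    obtain ⟨π, hπ, hle, heq⟩ := h.exists_support hu h01 f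
    refine IsLeast.csInf_eq ⟨⟨π, (hmem π).2 ⟨hπ, hle⟩, heq.symm⟩, ?_⟩
    rintro _ ⟨α, hα, rfl⟩
    exact ((hmem α).1 hα).2 f
  refine ⟨⟨hu, ⟨x₀, x₁, h01.ne⟩, fun α hα => hα.1, ?_, ?_, ?_, fun f g => ?_⟩, fun α hα s hs => ?_⟩
  · obtain ⟨π, hπ, hle, -⟩ := h.exists_support hu h01 (cst S x₀)
    exact ⟨π, (hmem π).2 ⟨hπ, hle⟩⟩
  · rw [hset]
    refine (isClosed_stdSimplex ℝ S).inter (isClosed_iInter fun f => ?_)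
    exact isClosed_le continuous_const (by fun_prop)
  · rw [hset]
    refine (convex_stdSimplex ℝ S).inter (convex_iInter fun f => ?_)
    intro α hα β hβ a b ha hb hab
    simp only [Set.mem_ofPred_eq] at hα hβ ⊢
    have : ∑ s, u (f s) * (a • α + b • β) s
        = a * ∑ s, u (f s) * α s + b * ∑ s, u (f s) * β s := by
      simp only [Finset.mul_sum, ← Finset.sum_add_distrib]
      refine Finset.sum_congr rfl fun s _ => ?_
      simp only [Pi.add_apply, Pi.smul_apply, smul_eq_mul]
      ring
    rw [this]
    have hb' : b = 1 - a := by linarith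
    subst hb'
    nlinarith
  · rw [hR, hval, hval]
  · obtain ⟨hα, hle⟩ := (hmem α).1 hα
    -- V sees only A, so it values this bet at u x₁; a probability charging a state off A values it
    -- less.
    have h1 := hle (splice (cst S x₁) A (cst S x₀))
    rw [h.congr (g := cst S x₁) fun s hs => by simp [splice, hs], h.cst] at h1
    by_contra hne
    have hpos : 0 < α s := lt_of_le_of_ne (hα.1 s) (Ne.symm hne)
    refine absurd h1 (not_le.2 ?_)
    calc ∑ j, u (splice (cst S x₁) A (cst S x₀) j) * α j < ∑ j, u x₁ * α j := by
          refine Finset.sum_lt_sum (fun j _ => ?_) ⟨s, Finset.mem_univ s, ?_⟩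
          · refine mul_le_mul_of_nonneg_right ?_ (hα.1 j)
            by_cases hj : j ∈ A <;> simp [splice, hj, cst, h01.le]
          · refine mul_lt_mul_of_pos_right ?_ hpos
            simpa [splice, hs, cst] using h01
      _ = u x₁ := by rw [← Finset.mul_sum, hα.2, mul_one]

/-! ### Maxmin values over compact sets of probabilities -/

theorem continuous_expect {S E : Type*} [Fintype S] {X : Set E} (u : X → ℝ) (f : S → X) :
    Continuous fun π : S → ℝ => ∑ s, u (f s) * π s := by
  fun_prop

theorem exists_meuValue_eq (u : X → ℝ) {C : Set (S → ℝ)} (hC : IsCompact C) (hne : C.Nonempty)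
    (f : S → X) : ∃ π ∈ C, ∑ s, u (f s) * π s = meuValue u C f :=
  (hC.image (continuous_expect u f)).sInf_mem (hne.image _)

theorem meuValue_le (u : X → ℝ) {C : Set (S → ℝ)} (hC : IsCompact C) (f : S → X) {π : S → ℝ}
    (hπ : π ∈ C) : meuValue u C f ≤ ∑ s, u (f s) * π s :=
  csInf_le (hC.image (continuous_expect u f)).bddBelow ⟨π, hπ, rfl⟩

theorem meuValue_eq_iff (u : X → ℝ) {C : Set (S → ℝ)} (hC : IsCompact C) (hne : C.Nonempty)
    (f : S → X) (c : ℝ) :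
    meuValue u C f = c ↔ (∀ π ∈ C, c ≤ ∑ s, u (f s) * π s) ∧ ∃ π ∈ C, ∑ s, u (f s) * π s = c := by
  constructor
  · rintro rfl
    exact ⟨fun π hπ => meuValue_le u hC f hπ, exists_meuValue_eq u hC hne f⟩
  · rintro ⟨h1, π, hπ, h2⟩
    obtain ⟨μ, hμ, h3⟩ := exists_meuValue_eq u hC hne f
    exact le_antisymm ((meuValue_le u hC f hπ).trans h2.le) ((h1 μ hμ).trans h3.le)

namespace IsMEURep

variable {hX : Convex ℝ X} {u : X → ℝ} {C : Set (S → ℝ)} {R : (S → X) → (S → X) → Prop}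

theorem isCompact (H : IsMEURep hX u C R) : IsCompact C :=
  (isCompact_stdSimplex ℝ S).of_isClosed_subset H.closed H.subset

theorem meuValue_cst (H : IsMEURep hX u C R) (x : X) : meuValue u C (cst S x) = u x := by
  have hval : ∀ π ∈ C, ∑ s, u (cst S x s) * π s = u x := fun π hπ => by
    simp only [cst, ← Finset.mul_sum, (H.subset hπ).2, mul_one]
  obtain ⟨π, hπ⟩ := H.nonempty
  rw [meuValue_eq_iff u H.isCompact H.nonempty]
  exact ⟨fun π hπ => (hval π hπ).ge, π, hπ, hval π hπ⟩

theorem rel_cst_iff (H : IsMEURep hX u C R) (x y : X) :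
    R (cst S x) (cst S y) ↔ u y ≤ u x := by
  rw [H.represents, H.meuValue_cst, H.meuValue_cst]

theorem indiff_cst_iff (H : IsMEURep hX u C R) (f : S → X) (x : X) :
    Indiff R f (cst S x) ↔ meuValue u C f = u x := by
  rw [Indiff, H.represents, H.represents, H.meuValue_cst, le_antisymm_iff, and_comm]

theorem exists_lt (H : IsMEURep hX u C R) : ∃ x₀ x₁, u x₀ < u x₁ := by
  obtain ⟨x, y, hxy⟩ := H.nonconstant
  rcases hxy.lt_or_gt with h | h
  exacts [⟨x, y, h⟩, ⟨y, x, h⟩]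

/-- A functional separating α from C, rescaled by `IsAffine.exists_act`, is an act whose expectation
under α falls below its maxmin value. -/
theorem prefersReduction_iff (H : IsMEURep hX u C R) (α : stdSimplex ℝ S) :
    PrefersReduction hX R α ↔ (α : S → ℝ) ∈ C := by
  have hred : ∀ f, R (reduce hX α f) f ↔ meuValue u C f ≤ ∑ s, u (f s) * (α : S → ℝ) s := by
    intro f
    rw [H.represents, reduce, H.meuValue_cst, IsAffine.map_reduceC H.affine]
  refine ⟨fun hp => ?_, fun hα f => (hred f).2 (meuValue_le u H.isCompact f hα)⟩
  classical
  by_contra hα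
  obtain ⟨φ, c, hφα, hφC⟩ := geometric_hahn_banach_point_closed H.convex H.closed hα
  have hφ : ∀ π : S → ℝ, φ π = ∑ s, φ (fun j => if s = j then 1 else 0) * π s := fun π => by
    rw [← ContinuousLinearMap.coe_coe, LinearMap.pi_apply_eq_sum_univ]
    simp [mul_comm]
  obtain ⟨x₀, x₁, h01⟩ := H.exists_lt
  obtain ⟨η, hη, h, hh⟩ := IsAffine.exists_act H.affine h01
    fun s : S => φ fun j => if s = j then 1 else 0
  have hval : ∀ π ∈ stdSimplex ℝ S, ∑ s, u (h s) * π s = (u x₁ + u x₀) / 2 + η * φ π := by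
    intro π hπ
    simp only [hh]
    rw [sum_mul_const_add hπ, ← hφ]
  obtain ⟨μ, hμ, hμe⟩ := exists_meuValue_eq u H.isCompact H.nonempty h
  have h1 := (hred h).1 (hp h)
  rw [← hμe, hval μ (H.subset hμ)] at h1
  have h3 : ∑ s, u (h s) * (α : S → ℝ) s = (u x₁ + u x₀) / 2 + η * φ (α : S → ℝ) := hval _ α.2
  have h2 : φ (α : S → ℝ) < φ μ := hφα.trans (hφC μ hμ)
  nlinarith

end IsMEURep

/-! ### Full Bayesian updating -/

theorem continuous_prob (A : Set S) : Continuous fun π : S → ℝ => prob π A := by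
  refine continuous_finsetSum _ fun s _ => ?_
  by_cases hs : s ∈ A
  · simpa [hs] using continuous_apply s
  · simpa [hs] using continuous_const

theorem sum_splice {S E : Type*} [Fintype S] {X : Set E} (u : X → ℝ) {π : S → ℝ}
    (hπ : π ∈ stdSimplex ℝ S) (A : Set S) (f : S → X) (x : X) : ∑ s, u (splice f A (cst S x) s) * π s
      = u x + (∑ s, u (f s) * A.indicator π s - u x * prob π A) := by
  have h1 : u x = ∑ s, u x * π s := by rw [← Finset.mul_sum, hπ.2, mul_one]
  conv_rhs => arg 1; rw [h1]
  rw [prob, Finset.mul_sum, ← Finset.sum_sub_distrib, ← Finset.sum_add_distrib]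
  refine Finset.sum_congr rfl fun s _ => ?_
  by_cases hs : s ∈ A <;> simp [splice, hs, cst]

theorem sum_splice_eq (u : X → ℝ) {π : S → ℝ} (hπ : π ∈ stdSimplex ℝ S) {A : Set S}
    (hA : 0 < prob π A) (f : S → X) (x : X) :
    ∑ s, u (splice f A (cst S x) s) * π s
      = u x + prob π A * (∑ s, u (f s) * condFun π A s - u x) := by
  rw [sum_splice u hπ]
  simp only [condFun, mul_div_assoc', ← Finset.sum_div]
  field_simp

theorem condFun_eq_self {π : S → ℝ} (hπ : π ∈ stdSimplex ℝ S) {A : Set S}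
    (hA : ∀ s, s ∉ A → π s = 0) : prob π A = 1 ∧ condFun π A = π := by
  have h1 : A.indicator π = π := Set.indicator_eq_self.2 fun s hs => by
    by_contra h
    exact hs (hA s h)
  have h2 : prob π A = 1 := by
    rw [prob, h1]
    exact hπ.2
  refine ⟨h2, funext fun s => ?_⟩
  rw [condFun, h2, h1, div_one]

/-- A prior with π(A) = 0 would value the bet x₁Ax₀ at u x₀ only. -/
theorem IsMEURep.prob_pos {hX : Convex ℝ X} {u : X → ℝ} {C : Set (S → ℝ)}
    {R : (S → X) → (S → X) → Prop} (H : IsMEURep hX u C R) {A : Set S} (hA : StronglyNonnull R A)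
    {π : S → ℝ} (hπ : π ∈ C) : 0 < prob π A := by
  obtain ⟨x₀, x₁, h01⟩ := H.exists_lt
  have h1 := hA x₁ x₀ ⟨(H.rel_cst_iff _ _).2 h01.le, fun h => h01.not_ge ((H.rel_cst_iff _ _).1 h)⟩
  have h2 := h1.2
  rw [H.represents, H.meuValue_cst, not_le] at h2
  have h3 := h2.trans_le (meuValue_le u H.isCompact _ hπ)
  rw [sum_splice u (H.subset hπ)] at h3
  simp only [cst, ← Finset.mul_sum] at h3
  rw [← prob] at h3
  by_contra! h
  nlinarith

theorem pbUpdate_zero {C : Set (S → ℝ)} {A : Set S} (hpos : ∀ π ∈ C, 0 < prob π A) :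
    pbUpdate C A 0 = (fun π => condFun π A) '' C := by
  ext q
  constructor
  · rintro ⟨π, hπ, -, -, rfl⟩
    exact ⟨π, hπ, rfl⟩
  · rintro ⟨π, hπ, rfl⟩
    exact ⟨π, hπ, hpos π hπ, by rw [zero_mul]; exact (hpos π hπ).le, rfl⟩

theorem isCompact_image_condFun {C : Set (S → ℝ)} (hC : IsCompact C) {A : Set S}
    (hpos : ∀ π ∈ C, 0 < prob π A) : IsCompact ((fun π => condFun π A) '' C) := by
  refine hC.image_of_continuousOn (continuousOn_pi.2 fun s => ?_)
  refine ContinuousOn.div ?_ (continuous_prob A).continuousOn fun π hπ => (hpos π hπ).ne'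
  by_cases hs : s ∈ A
  · simpa [hs] using (continuous_apply s).continuousOn
  · simpa [hs] using continuousOn_const

theorem prob_comb (a b : ℝ) (π μ : S → ℝ) (A : Set S) :
    prob (a • π + b • μ) A = a * prob π A + b * prob μ A := by
  simp only [prob, Finset.mul_sum, ← Finset.sum_add_distrib]
  refine Finset.sum_congr rfl fun s _ => ?_
  by_cases hs : s ∈ A <;> simp [hs]

theorem convex_image_condFun {C : Set (S → ℝ)} (hC : Convex ℝ C) {A : Set S}
    (hpos : ∀ π ∈ C, 0 < prob π A) : Convex ℝ ((fun π => condFun π A) '' C) := by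
  rintro _ ⟨π, hπ, rfl⟩ _ ⟨μ, hμ, rfl⟩ a b ha hb hab
  have hp := hpos π hπ
  have hm := hpos μ hμ
  set p := prob π A
  set m := prob μ A
  have hN : 0 < a * m + b * p := by
    rcases ha.eq_or_lt with h | h
    · have hb1 : b = 1 := by linarith
      rw [← h, hb1]
      linarith
    · have := mul_pos h hm
      have := mul_nonneg hb hp.le
      linarith
  -- Conditioning multiplies each weight by that prior's probability of A; the normalized weights
  -- a/p and b/m undo this.
  refine ⟨(a * m / (a * m + b * p)) • π + (b * p / (a * m + b * p)) • μ,
    hC hπ hμ (by positivity) (by positivity) (by field_simp), funext fun s => ?_⟩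
  have hprob : prob ((a * m / (a * m + b * p)) • π + (b * p / (a * m + b * p)) • μ) A
      = p * m / (a * m + b * p) := by
    rw [prob_comb]
    change _ * p + _ * m = _
    rw [div_mul_eq_mul_div, div_mul_eq_mul_div, ← add_div]
    congr 1
    linear_combination p * m * hab
  simp only [condFun, hprob, Pi.add_apply, Pi.smul_apply, smul_eq_mul]
  change _ = a * (_ / p) + b * (_ / m)
  by_cases hs : s ∈ A
  · simp only [Set.indicator_of_mem hs, Pi.add_apply, Pi.smul_apply, smul_eq_mul]
    field_simp
  · simp [hs]

/-- The factor π(A) > 0 preserves signs and zeros, hence both the lower bound and its attainment. -/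
theorem meuValue_splice_eq_iff (u : X → ℝ) {C : Set (S → ℝ)} (hC : IsCompact C)
    (hne : C.Nonempty) (hsub : C ⊆ stdSimplex ℝ S) {A : Set S}
    (hpos : ∀ π ∈ C, 0 < prob π A) (f : S → X) (x : X) :
    meuValue u C (splice f A (cst S x)) = u x ↔ meuValue u (pbUpdate C A 0) f = u x := by
  rw [pbUpdate_zero hpos, meuValue_eq_iff u hC hne,
    meuValue_eq_iff u (isCompact_image_condFun hC hpos) (hne.image _)]
  have key : ∀ π ∈ C, ∑ s, u (splice f A (cst S x) s) * π s
      = u x + prob π A * (∑ s, u (f s) * condFun π A s - u x) :=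
    fun π hπ => sum_splice_eq u (hsub hπ) (hpos π hπ) f x
  refine and_congr ⟨?_, fun h π hπ => ?_⟩ ⟨?_, ?_⟩
  · rintro h _ ⟨π, hπ, rfl⟩
    have h1 := h π hπ
    rw [key π hπ, le_add_iff_nonneg_right] at h1
    exact sub_nonneg.1 (nonneg_of_mul_nonneg_right h1 (hpos π hπ))
  · rw [key π hπ]
    have := mul_nonneg (hpos π hπ).le (sub_nonneg.2 (h _ ⟨π, hπ, rfl⟩))
    linarith
  · rintro ⟨π, hπ, h⟩
    refine ⟨_, ⟨π, hπ, rfl⟩, ?_⟩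
    rw [key π hπ, add_eq_left, mul_eq_zero] at h
    exact sub_eq_zero.1 (h.resolve_left (hpos π hπ).ne')
  · rintro ⟨_, ⟨π, hπ, rfl⟩, h⟩
    refine ⟨π, hπ, ?_⟩
    rw [key π hπ, sub_eq_zero.2 h, mul_zero, add_zero]

/-! ### Full Bayesian updating and the two consistency conditions -/

section Update

variable {hX : Convex ℝ X} {pref : Set S → (S → X) → (S → X) → Prop} {u : X → ℝ}
  {C : Set (S → ℝ)} {A : Set S}

theorem IsPBRepAt.certaintyEquivConsistent (H : IsPBRepAt hX pref u C A 0)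
    (hA : StronglyNonnull (pref Set.univ) A) : CertaintyEquivConsistent pref A := by
  obtain ⟨-, HS, HA⟩ := H
  intro f x
  rw [HS.indiff_cst_iff, HA.indiff_cst_iff]
  exact meuValue_splice_eq_iff u HS.isCompact HS.nonempty HS.subset
    (fun π hπ => HS.prob_pos hA hπ) f x

theorem IsPBRepAt.reductionConsistent (H : IsPBRepAt hX pref u C A 0)
    (hA : StronglyNonnull (pref Set.univ) A) : ReductionConsistent hX pref A := by
  obtain ⟨-, HS, HA⟩ := H
  have hpos : ∀ π ∈ C, 0 < prob π A := fun π hπ => HS.prob_pos hA hπ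
  intro α hα
  rw [HS.prefersReduction_iff, HA.prefersReduction_iff, pbUpdate_zero hpos]
  refine ⟨fun h => ⟨_, h, rfl⟩, ?_⟩
  rintro ⟨π, hπ, h⟩
  exact ⟨⟨π, HS.subset hπ⟩, hpos π hπ, Subtype.ext h, (HS.prefersReduction_iff _).2 hπ⟩

theorem ReductionConsistent.isPBRepAt
    (HS : IsMEURep hX u (acceptable hX (pref Set.univ)) (pref Set.univ))
    (HA : IsMEURep hX u (acceptable hX (pref A)) (pref A))
    (hsupp : ∀ α ∈ acceptable hX (pref A), ∀ s, s ∉ A → α s = 0)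
    (hA : StronglyNonnull (pref Set.univ) A) (h : ReductionConsistent hX pref A) :
    IsPBRepAt hX pref u (acceptable hX (pref Set.univ)) A 0 := by
  have hpos : ∀ π ∈ acceptable hX (pref Set.univ), 0 < prob π A := fun π hπ => HS.prob_pos hA hπ
  have heq : pbUpdate (acceptable hX (pref Set.univ)) A 0 = acceptable hX (pref A) := by
    rw [pbUpdate_zero hpos]
    ext q
    constructor
    · rintro ⟨π, hπ, rfl⟩
      exact ⟨condFun_mem hπ.1 (hpos π hπ), (h ⟨π, hπ.1⟩ (hpos π hπ)).1 hπ.2⟩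
    · intro hq
      -- Being supported on A, `q` is its own update, so part (b) applies with α = q.
      obtain ⟨h1, h2⟩ := condFun_eq_self hq.1 (hsupp q hq)
      have h0 : 0 < prob q A := by rw [h1]; exact one_pos
      have h3 : condRand ⟨q, hq.1⟩ A h0 = ⟨q, hq.1⟩ := Subtype.ext h2
      obtain ⟨β, hβ, h4, h5⟩ := (h ⟨q, hq.1⟩ h0).2 (by rw [h3]; exact hq.2)
      exact ⟨β, ⟨β.2, h5⟩, congrArg Subtype.val (h4.trans h3)⟩
  exact ⟨⟨le_rfl, zero_le_one⟩, HS, heq ▸ HA⟩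

/-- The sets `D` and `pbUpdate C A 0` need not be compared: their maxmin values agree at every act,
by way of its certainty equivalent. -/
theorem CertaintyEquivConsistent.isPBRepAt (HS : IsMEURep hX u C (pref Set.univ))
    {D : Set (S → ℝ)} (HA : IsMEURep hX u D (pref A))
    (hce : ∀ f, ∃ x, Indiff (pref A) f (cst S x))
    (hA : StronglyNonnull (pref Set.univ) A) (h : CertaintyEquivConsistent pref A) :
    IsPBRepAt hX pref u C A 0 := by
  have hpos : ∀ π ∈ C, 0 < prob π A := fun π hπ => HS.prob_pos hA hπ
  have hval : ∀ f, meuValue u (pbUpdate C A 0) f = meuValue u D f := fun f => by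
    obtain ⟨x, hx⟩ := hce f
    rw [(HA.indiff_cst_iff f x).1 hx, ← meuValue_splice_eq_iff u HS.isCompact HS.nonempty HS.subset
      hpos, ← HS.indiff_cst_iff]
    exact (h f x).2 hx
  refine ⟨⟨le_rfl, zero_le_one⟩, HS, HS.affine, HS.nonconstant, ?_, ?_, ?_, ?_, fun f g => ?_⟩
  · rw [pbUpdate_zero hpos]
    rintro _ ⟨π, hπ, rfl⟩
    exact condFun_mem (HS.subset hπ) (hpos π hπ)
  · rw [pbUpdate_zero hpos]
    exact HS.nonempty.image _
  · rw [pbUpdate_zero hpos]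
    exact (isCompact_image_condFun HS.isCompact hpos).isClosed
  · rw [pbUpdate_zero hpos]
    exact convex_image_condFun HS.convex hpos
  · rw [HA.represents, hval, hval]

end Update

theorem ConditionalMEU.exists_common_utility [Nonempty S] {hX : Convex ℝ X} {𝒮 : Set (Set S)}
    (hS : Set.univ ∈ 𝒮) {pref : Set S → (S → X) → (S → X) → Prop}
    (H : ConditionalMEU hX 𝒮 pref) :
    ∃ u : X → ℝ, ∀ A ∈ 𝒮, A.Nonempty →
      IsMEURep hX u (acceptable hX (pref A)) (pref A) ∧
        (∀ α ∈ acceptable hX (pref A), ∀ s, s ∉ A → α s = 0) ∧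
        ∀ f, ∃ x, Indiff (pref A) f (cst S x) := by
  have hv := (H _ hS Set.univ_nonempty).isVNM
  obtain ⟨g, hg⟩ := hv.exists_linear
  have hu : IsAffine hX fun x : X => g x := fun x y t => by
    simp [coe_mixC]
  obtain ⟨x₁, x₀, h10⟩ := hv.nontrivial
  have h01 : g x₀ < g x₁ := by
    rw [← not_le, ← hg]
    exact h10.2
  refine ⟨fun x => g x, fun A hA hne => ?_⟩
  have HA := H A hA hne
  have hrep : ∀ x y : X, pref A (cst S x) (cst S y) ↔ g y ≤ g x := fun x y => by
    rw [← HA.ordinal_consistency, hg]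
  obtain ⟨V, hV, hR⟩ := HA.exists_functional hne hu hrep
  obtain ⟨h1, h2⟩ := isMEURep_acceptable hV hu h01 hR
  exact ⟨h1, h2, HA.exists_indiff_cst hne hu hrep⟩

/-- Needed because the postulates cover nonempty events only. -/
theorem IsMEURep.nonempty_of_stronglyNonnull {hX : Convex ℝ X} {u : X → ℝ} {C : Set (S → ℝ)}
    {R : (S → X) → (S → X) → Prop} (H : IsMEURep hX u C R) {A : Set S}
    (hA : StronglyNonnull R A) : A.Nonempty := by
  obtain ⟨π, hπ⟩ := H.nonempty
  rw [Set.nonempty_iff_ne_empty]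
  rintro rfl
  simpa [prob] using H.prob_pos hA hπ

end PBU

theorem proposition1 {S E : Type*} [Fintype S] [Nonempty S] [AddCommGroup E] [Module ℝ E]
    {X : Set E} (hX : Convex ℝ X)
    (𝒮 : Set (Set S)) (h𝒮 : MeasureTheory.IsSetAlgebra 𝒮)
    (pref : Set S → (S → X) → (S → X) → Prop)
    (hMEU : PBU.ConditionalMEU hX 𝒮 pref)
    (hCon : PBU.Consequentialism 𝒮 pref) :
    -- existence of an acceptable randomization supported on each nonempty event
    (∀ A ∈ 𝒮, A.Nonempty → ∃ α : stdSimplex ℝ S,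
      (∀ s, s ∉ A → (α : S → ℝ) s = 0) ∧ PBU.PrefersReduction hX (pref A) α) ∧
    -- characterization of full Bayesian updating at each strongly nonnull event
    (∀ A ∈ 𝒮, PBU.StronglyNonnull (pref Set.univ) A →
      List.TFAE [
        ∃ (u : X → ℝ) (C : Set (S → ℝ)), PBU.IsPBRepAt hX pref u C A 0,
        PBU.ReductionConsistent hX pref A,
        PBU.CertaintyEquivConsistent pref A]) ∧
    -- the same for all strongly nonnull events together, with one common representation
    List.TFAE [
      ∃ (u : X → ℝ) (C : Set (S → ℝ)) (ρ : Set S → ℝ), PBU.IsPBRep hX 𝒮 pref u C ρ ∧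
        ∀ A ∈ 𝒮, PBU.StronglyNonnull (pref Set.univ) A → ρ A = 0,
      ∀ A ∈ 𝒮, PBU.StronglyNonnull (pref Set.univ) A → PBU.ReductionConsistent hX pref A,
      ∀ A ∈ 𝒮, PBU.StronglyNonnull (pref Set.univ) A → PBU.CertaintyEquivConsistent pref A] := by

  have huniv : Set.univ ∈ 𝒮 := by simpa using h𝒮.compl_mem h𝒮.empty_mem
  obtain ⟨u, hu⟩ := hMEU.exists_common_utility huniv
  have HS := (hu _ huniv Set.univ_nonempty).1
  have hne : ∀ A, PBU.StronglyNonnull (pref Set.univ) A → A.Nonempty := fun A hA =>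
    HS.nonempty_of_stronglyNonnull hA
  -- Neither `u` nor the prior set depends on A, so the eventwise results combine into one common
  -- representation.
  have hred : ∀ A ∈ 𝒮, PBU.StronglyNonnull (pref Set.univ) A →
      PBU.ReductionConsistent hX pref A →
      PBU.IsPBRepAt hX pref u (PBU.acceptable hX (pref Set.univ)) A 0 := fun A hA hn h =>
    h.isPBRepAt HS (hu A hA (hne A hn)).1 (hu A hA (hne A hn)).2.1 hn
  have hce : ∀ A ∈ 𝒮, PBU.StronglyNonnull (pref Set.univ) A →
      PBU.CertaintyEquivConsistent pref A →
      PBU.IsPBRepAt hX pref u (PBU.acceptable hX (pref Set.univ)) A 0 := fun A hA hn h =>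
    h.isPBRepAt HS (hu A hA (hne A hn)).1 (hu A hA (hne A hn)).2.2 hn
  refine ⟨fun A hA hA' => ?_, fun A hA hn => ?_, ?_⟩
  · obtain ⟨h1, h2, -⟩ := hu A hA hA'
    obtain ⟨α, hα⟩ := h1.nonempty
    exact ⟨⟨α, hα.1⟩, h2 α hα, hα.2⟩
  · tfae_have 1 → 2 := fun ⟨_, _, h⟩ => h.reductionConsistent hn
    tfae_have 1 → 3 := fun ⟨_, _, h⟩ => h.certaintyEquivConsistent hn
    tfae_have 2 → 1 := fun h => ⟨_, _, hred A hA hn h⟩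
    tfae_have 3 → 1 := fun h => ⟨_, _, hce A hA hn h⟩
    tfae_finish
  · tfae_have 1 → 2 := fun ⟨v, C, ρ, h, h0⟩ A hA hn => by
      have := h.2 A hA hn
      rw [h0 A hA hn] at this
      exact this.reductionConsistent hn
    tfae_have 1 → 3 := fun ⟨v, C, ρ, h, h0⟩ A hA hn => by
      have := h.2 A hA hn
      rw [h0 A hA hn] at this
      exact this.certaintyEquivConsistent hn
    tfae_have 2 → 1 := fun h => ⟨u, _, fun _ => 0,
      ⟨HS, fun A hA hn => hred A hA hn (h A hA hn)⟩, fun _ _ _ => rfl⟩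
    tfae_have 3 → 1 := fun h => ⟨u, _, fun _ => 0,
      ⟨HS, fun A hA hn => hce A hA hn (h A hA hn)⟩, fun _ _ _ => rfl⟩
    tfae_finish
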